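/- A permutation is a finite word over the positive integers without repeated letters; $S_n$ is the set of permutations whose set of letters is $\{1,\dots,n\}$. The stack-sorting map $s$ is defined recursively: $s$ fixes the empty word, and if $\pi=LnR$ has largest entry $n$, then $s(\pi)=s(L)\,s(R)\,n$. A permutation $\pi$ is uniquely sorted if it has exactly one preimage under $s$, that is, $|s^{-1}(\pi)|=1$. A permutation $\sigma$ avoids a pattern $\tau$ if no subsequence of $\sigma$ has the same relative order as $\tau$. Let $\mathcal U_n(\tau^{(1)},\dots,\tau^{(r)})$ be the set of uniquely sorted permutations in $S_n$ that avoid all of the patterns $\tau^{(1)},\dots,\tau^{(r)}$. For each nonnegative integer $k$, we have $$|\mathcal U_{2k+1}(231,321)|=|\mathcal U_{2k+1}(312,321)|=|\mathcal U_{2k+1}(231,312,321)|=|\mathcal U_{2k+1}(132,231,312)|=1.$$ For each $k\ge 2$, we have $\mathcal U_{2k+1}(132,321)=\emptyset$. -/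

import Mathlib

/-- A permutation, in one-line notation: a finite word over the positive integers
without repeated letters. -/
def IsPermWord (w : List ℕ) : Prop :=
  w.Nodup ∧ ∀ a ∈ w, 0 < a

/-- The largest entry of a word (and `0` for the empty word). -/
def maxEntry (w : List ℕ) : ℕ :=
  w.foldr max 0

theorem maxEntry_mem {w : List ℕ} (h : w ≠ []) : maxEntry w ∈ w := by
  induction w with
  | nil => exact absurd rfl h
  | cons a l ih =>
    by_cases hl : l = []
    · subst hl; simp [maxEntry]
    · have h2 := ih hl
      have h3 : maxEntry (a :: l) = max a (maxEntry l) := rfl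
      rcases max_choice a (maxEntry l) with h4 | h4
      · rw [h3, h4]; simp
      · rw [h3, h4]; exact List.mem_cons_of_mem a h2

/-- West's stack-sorting map `s`: the empty word is sent to itself, and a word `L n R` with largest
entry `n` is sent to `s(L) s(R) n`. -/
def stackSort (w : List ℕ) : List ℕ :=
  if h : w = [] then []
  else
    have hm : w.idxOf (maxEntry w) < w.length := List.idxOf_lt_length_of_mem (maxEntry_mem h)
    stackSort (w.take (w.idxOf (maxEntry w))) ++
      stackSort (w.drop (w.idxOf (maxEntry w) + 1)) ++ [maxEntry w]
termination_by w.length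
decreasing_by
  · simp only [List.length_take]; omega
  · simp only [List.length_drop]; omega

/-- The fertility of a permutation `π`: the number of permutations `σ` with `s(σ) = π`. -/
noncomputable def fertility (π : List ℕ) : ℕ∞ :=
  {σ : List ℕ | IsPermWord σ ∧ stackSort σ = π}.encard

/-- A permutation is uniquely sorted if its fertility is `1`. -/
def IsUniquelySorted (π : List ℕ) : Prop :=
  fertility π = 1

/-- `permsOf n` is `S_n`, the set of permutations of `{1, …, n}` in one-line notation. -/
def permsOf (n : ℕ) : Set (List ℕ) :=
  {π | π.Perm (List.range' 1 n)}

/-- The normalization of a permutation: its `i`-th smallest entry is replaced by `i`, that is, each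
entry `a` is replaced by the number of entries that are at most `a`. -/
def normalization (w : List ℕ) : List ℕ :=
  w.map fun a => (w.filter fun b => b ≤ a).length

/-- `σ` contains the pattern `τ` if some subsequence of `σ` has the same relative order as `τ`. -/
def ContainsPattern (σ τ : List ℕ) : Prop :=
  ∃ ρ : List ℕ, ρ.Sublist σ ∧ normalization ρ = normalization τ

/-- `uniquelySortedAvoiding n T` is `U_n(T)`, the set of uniquely sorted permutations in `S_n` that
avoid every pattern in `T`. -/
def uniquelySortedAvoiding (n : ℕ) (T : Set (List ℕ)) : Set (List ℕ) :=
  {π | π ∈ permsOf n ∧ IsUniquelySorted π ∧ ∀ τ ∈ T, ¬ ContainsPattern π τ}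

/-! The engine is a descent criterion: a permutation of length n ≥ 1 is uniquely sorted exactly when
it is sorted and has (n - 1)/2 descents (`isUniquelySorted_iff_des`). Since s(A m B) = s(A) s(B) m,
induction bounds the descents of a sorted word of length n by (n - 1)/2, and the same bound holds
for each nonempty suffix (`two_mul_des_suffix_lt`). Uniqueness of the preimage forces equality,
because any slack allows letters to be regrouped into a second preimage. Conversely, equality
together with the suffix bound leaves only one place to cut s(A) s(B).

The patterns then fix the word. Under 321-avoidance a word with this many descents starts with a
descent, and removing its first two letters leaves a word of the same kind
(`DescentTight.tail_tail`). Avoiding also 231 or 312 forces 2 1 4 3 ... (2k+1)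
(`DescentTight.pairLayered`); avoiding also 132 is impossible as soon as there are two such pairs.
Avoiding 132, 231 and 312 forces a decreasing run followed by an increasing run of larger letters
(`exists_isValley`), and the descent count fixes where the first run ends. -/

/-! ### Descents of concatenated words. -/

/-- The number of descents of a word. -/
def des : List ℕ → ℕ
  | a :: b :: t => (if b < a then 1 else 0) + des (b :: t)
  | _ => 0

@[simp] theorem des_nil : des [] = 0 := rfl

@[simp] theorem des_singleton (a : ℕ) : des [a] = 0 := rfl

theorem des_cons_cons (a b : ℕ) (t : List ℕ) :
    des (a :: b :: t) = (if b < a then 1 else 0) + des (b :: t) := rfl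

theorem des_concat_append_cons (u : List ℕ) (x y : ℕ) (v : List ℕ) :
    des ((u ++ [x]) ++ y :: v) = des (u ++ [x]) + (if y < x then 1 else 0) + des (y :: v) := by
  induction u with
  | nil => simp [des_cons_cons]
  | cons a u ih =>
    cases u with
    | nil => simp [des_cons_cons] at ih ⊢; omega
    | cons b u =>
      simp only [List.cons_append, des_cons_cons] at ih ⊢
      omega

theorem des_append_le (u v : List ℕ) : des (u ++ v) ≤ des u + des v + 1 := by
  rcases List.eq_nil_or_concat' u with rfl | ⟨u, x, rfl⟩
  · simp
  · cases v with
    | nil => simp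
    | cons y v =>
      rw [des_concat_append_cons]
      split <;> omega

theorem des_concat_of_le (u : List ℕ) (m : ℕ) (h : ∀ x ∈ u, x ≤ m) : des (u ++ [m]) = des u := by
  rcases List.eq_nil_or_concat' u with rfl | ⟨u, x, rfl⟩
  · simp
  · have hx : x ≤ m := h x (by simp)
    rw [des_concat_append_cons, if_neg (by omega)]
    simp

/-! ### Elementary properties of the stack-sorting map. -/

theorem le_maxEntry {w : List ℕ} {x : ℕ} (h : x ∈ w) : x ≤ maxEntry w := by
  induction w with
  | nil => simp at h
  | cons a l ih =>
    have h3 : maxEntry (a :: l) = max a (maxEntry l) := rfl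
    rw [h3]
    rcases List.mem_cons.1 h with rfl | h
    · exact le_max_left _ _
    · exact (ih h).trans (le_max_right _ _)

@[simp] theorem stackSort_nil : stackSort [] = [] := by
  rw [stackSort]; simp

theorem stackSort_append_cons {A B : List ℕ} {m : ℕ} (hA : ∀ x ∈ A, x < m)
    (hB : ∀ x ∈ B, x < m) :
    stackSort (A ++ m :: B) = stackSort A ++ stackSort B ++ [m] := by
  have hmax : maxEntry (A ++ m :: B) = m := by
    apply le_antisymm
    · have := maxEntry_mem (w := A ++ m :: B) (by simp)
      rcases List.mem_append.1 this with h | h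
      · exact (hA _ h).le
      · rcases List.mem_cons.1 h with h | h
        · exact h.le
        · exact (hB _ h).le
    · exact le_maxEntry (by simp)
  have hidx : (A ++ m :: B).idxOf m = A.length := by
    rw [List.idxOf_append_of_notMem (fun h => lt_irrefl _ (hA _ h))]
    simp
  rw [stackSort, dif_neg (by simp)]
  simp only [hmax, hidx]
  simp

@[simp] theorem stackSort_singleton (a : ℕ) : stackSort [a] = [a] := by
  simpa using stackSort_append_cons (A := []) (B := []) (m := a) (by simp) (by simp)

theorem stackSort_perm (w : List ℕ) : (stackSort w).Perm w := by
  induction h : w.length using Nat.strong_induction_on generalizing w with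
  | _ n ih =>
    by_cases hw : w = []
    · subst hw; simp
    · have hm := List.idxOf_lt_length_of_mem (maxEntry_mem hw)
      rw [stackSort, dif_neg hw]
      have h1 := ih _ (by simp only [List.length_take]; omega)
        (w.take (w.idxOf (maxEntry w))) rfl
      have h2 := ih _ (by simp only [List.length_drop]; omega)
        (w.drop (w.idxOf (maxEntry w) + 1)) rfl
      have h3 : w = w.take (w.idxOf (maxEntry w)) ++
          maxEntry w :: w.drop (w.idxOf (maxEntry w) + 1) := by
        conv_lhs => rw [← List.take_append_drop (w.idxOf (maxEntry w)) w]
        rw [List.drop_eq_getElem_cons hm, List.getElem_idxOf]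
      refine (((h1.append h2).append_right _)).trans ?_
      conv_rhs => rw [h3]
      rw [List.append_assoc]
      exact (List.perm_append_singleton _ _).append_left _

@[simp] theorem length_stackSort (w : List ℕ) : (stackSort w).length = w.length :=
  (stackSort_perm w).length_eq

@[simp] theorem mem_stackSort {w : List ℕ} {x : ℕ} : x ∈ stackSort w ↔ x ∈ w :=
  (stackSort_perm w).mem_iff

@[simp] theorem stackSort_eq_nil {w : List ℕ} : stackSort w = [] ↔ w = [] := by
  rw [← List.length_eq_zero_iff, length_stackSort, List.length_eq_zero_iff]

theorem exists_eq_append_max_cons {w : List ℕ} (hw : w ≠ []) (hn : w.Nodup) :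
    ∃ A m B, w = A ++ m :: B ∧ (∀ x ∈ A, x < m) ∧ (∀ x ∈ B, x < m) := by
  obtain ⟨A, B, h⟩ := List.append_of_mem (maxEntry_mem hw)
  have hle : ∀ x ∈ w, x ≤ maxEntry w := fun x hx => le_maxEntry hx
  generalize maxEntry w = m at h hle
  subst h
  have hnA : m ∉ A := fun hA => by
    have := (List.nodup_append.1 hn).2.2 m hA m (by simp)
    exact this rfl
  have hnB : m ∉ B := (List.nodup_cons.1 (List.nodup_append.1 hn).2.1).1
  refine ⟨A, m, B, rfl, fun x hx => ?_, fun x hx => ?_⟩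
  · exact lt_of_le_of_ne (hle x (by simp [hx])) (fun h => hnA (h ▸ hx))
  · exact lt_of_le_of_ne (hle x (by simp [hx])) (fun h => hnB (h ▸ hx))

/-- Induction on words without repeated letters along the decomposition at the largest entry. -/
@[elab_as_elim]
theorem nodup_max_induction {P : (w : List ℕ) → w.Nodup → Prop} (nil : P [] List.nodup_nil)
    (step : ∀ A m B, (∀ x ∈ A, x < m) → (∀ x ∈ B, x < m) → ∀ (h : (A ++ m :: B).Nodup)
      (hA : A.Nodup) (hB : B.Nodup), P A hA → P B hB → P (A ++ m :: B) h)
    (w : List ℕ) (hw : w.Nodup) : P w hw := by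
  induction h : w.length using Nat.strong_induction_on generalizing w with
  | _ n ih =>
    by_cases h0 : w = []
    · subst h0; exact nil
    · obtain ⟨A, m, B, rfl, hA, hB⟩ := exists_eq_append_max_cons h0 hw
      have h1 := List.nodup_append.1 hw
      have h2 := (List.nodup_cons.1 h1.2.1).2
      simp only [List.length_append, List.length_cons] at h
      exact step A m B hA hB hw h1.1 h2 (ih _ (by omega) A h1.1 rfl) (ih _ (by omega) B h2 rfl)

/-! ### The descent bound and the criterion for being uniquely sorted. -/

/-- In every nonempty suffix of a sorted word, the descents are fewer than half of the letters. -/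
theorem two_mul_des_suffix_lt (w : List ℕ) (hw : w.Nodup) :
    ∀ W, W <:+ stackSort w → W ≠ [] → 2 * des W + 1 ≤ W.length := by
  induction w, hw using nodup_max_induction with
  | nil => intro W h h0; simp at h; exact absurd h h0
  | step A m B hA hB _ _ _ ihA ihB =>
    intro W h h0
    rw [stackSort_append_cons hA hB] at h
    have hB' : 2 * des (stackSort B) ≤ (stackSort B).length - 1 := by
      by_cases hb : stackSort B = []
      · simp [hb]
      · have := ihB _ (List.suffix_refl _) hb; omega
    rcases List.suffix_concat_iff.1 h with rfl | ⟨V, rfl, hV⟩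
    · exact absurd rfl h0
    · have hVm : ∀ x ∈ V, x ≤ m := by
        intro x hx
        have := hV.subset hx
        simp only [List.mem_append, mem_stackSort] at this
        rcases this with h | h
        · exact (hA x h).le
        · exact (hB x h).le
      have hdes : des (V ++ [m]) = des V := des_concat_of_le V m hVm
      rw [hdes, List.length_append, List.length_singleton]
      by_cases hV0 : V = []
      · simp [hV0]
      obtain ⟨P, hP⟩ := hV
      -- `V` is either `Z` followed by s(B), with `Z` a suffix of s(A), or a suffix of s(B). In the
      -- first case the seam adds at most one descent, which the slack in the two bounds and the
      -- final `m` pay for.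
      rcases List.append_eq_append_iff.1 hP with ⟨Z, hZ, rfl⟩ | ⟨Z, rfl, hZ⟩
      rotate_left
      · have := ihB V ⟨Z, hZ.symm⟩ hV0; omega
      · by_cases hZ0 : Z = []
        · subst hZ0; simp only [List.nil_append]; omega
        have h1 := ihA Z ⟨P, hZ.symm⟩ hZ0
        by_cases hb : stackSort B = []
        · simp only [hb, List.append_nil]; omega
        have h2 := ihB _ (List.suffix_refl _) hb
        have h3 := des_append_le Z (stackSort B)
        rw [List.length_append]
        omega

theorem two_mul_des_stackSort_lt {w : List ℕ} (hw : w.Nodup) (h0 : w ≠ []) :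
    2 * des (stackSort w) + 1 ≤ w.length := by
  simpa using two_mul_des_suffix_lt w hw _ (List.suffix_refl _) (by simpa using h0)

/-- If all letters of `L` are smaller than the first letter of `s(R)`, then `L` can be grafted
onto the first leaf of `R`. -/
theorem exists_stackSort_eq_append {L : List ℕ} (R : List ℕ) (hR : R.Nodup) :
    ∀ y t, stackSort R = y :: t → (∀ x ∈ L, x < y) →
      ∃ S, stackSort S = stackSort L ++ stackSort R := by
  induction R, hR using nodup_max_induction with
  | nil => intro y t h; simp at h
  | step A m B hA hB _ _ _ ihA ihB =>
    intro y t h hL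
    have hLm : ∀ x ∈ L, x < m := by
      have hy : y ∈ A ++ m :: B := by rw [← mem_stackSort, h]; simp
      have : y ≤ m := by
        simp only [List.mem_append, List.mem_cons] at hy
        rcases hy with h | h | h
        · exact (hA _ h).le
        · exact h.le
        · exact (hB _ h).le
      intro x hx
      exact (hL x hx).trans_le this
    rw [stackSort_append_cons hA hB] at h ⊢
    have key : ∀ S : List ℕ, ∀ C, stackSort S = stackSort L ++ stackSort C → (∀ x ∈ C, x < m) →
        ∀ x ∈ S, x < m := by
      intro S C hS hC x hx
      rw [← mem_stackSort, hS] at hx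
      simp only [List.mem_append, mem_stackSort] at hx
      exact hx.elim (hLm x) (hC x)
    -- The graft goes where the first letter of s(R) comes from: into `A` if it is nonempty,
    -- otherwise into `B`, otherwise directly to the left of `m`.
    by_cases hA0 : A = []
    · subst hA0
      by_cases hB0 : B = []
      · subst hB0
        refine ⟨L ++ m :: [], ?_⟩
        rw [stackSort_append_cons hLm (by simp)]
        simp
      · obtain ⟨y', t', hyt⟩ := List.exists_cons_of_ne_nil (mt stackSort_eq_nil.1 hB0)
        have : y' = y := by simp [hyt] at h; exact h.1
        subst this
        obtain ⟨S, hS⟩ := ihB y' t' hyt hL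
        refine ⟨[] ++ m :: S, ?_⟩
        rw [stackSort_append_cons (by simp) (key S B hS hB), hS]
        simp
    · obtain ⟨y', t', hyt⟩ := List.exists_cons_of_ne_nil (mt stackSort_eq_nil.1 hA0)
      have : y' = y := by simp [hyt] at h; exact h.1
      subst this
      obtain ⟨S, hS⟩ := ihA y' t' hyt hL
      refine ⟨S ++ m :: B, ?_⟩
      rw [stackSort_append_cons (key S A hS hA) hB, hS]
      simp

theorem append_singleton_ne_cons {S : List ℕ} {m : ℕ} (hS : ∀ x ∈ S, x < m) (h0 : S ≠ []) :
    S ++ [m] ≠ m :: S := by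
  obtain ⟨a, t, rfl⟩ := List.exists_cons_of_ne_nil h0
  intro h
  simp only [List.cons_append, List.cons.injEq] at h
  exact absurd h.1 (hS a (by simp)).ne

/-- If `s(w)` has no preimage other than `w`, then it has exactly `(|w| - 1) / 2` descents. -/
theorem two_mul_des_add_one_of_unique (w : List ℕ) (hw : w.Nodup) :
    w ≠ [] → (∀ v, stackSort v = stackSort w → v = w) →
      2 * des (stackSort w) + 1 = w.length := by
  induction w, hw using nodup_max_induction with
  | nil => intro h; exact absurd rfl h
  | step A m B hA hB hn hnA hnB ihA ihB =>
    intro _ huniq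
    have hs := stackSort_append_cons hA hB
    -- Such an `S` would make both `S m` and `m S` preimages, and these differ unless `S` is empty.
    have flip : ∀ S, stackSort S = stackSort A ++ stackSort B → S = [] := by
      intro S hS
      by_contra h0
      have hSm : ∀ x ∈ S, x < m := by
        intro x hx
        rw [← mem_stackSort, hS] at hx
        simp only [List.mem_append, mem_stackSort] at hx
        exact hx.elim (hA x) (hB x)
      have h1 := huniq (S ++ m :: [])
        (by rw [stackSort_append_cons hSm (by simp), hs, hS]; simp)
      have h2 := huniq ([] ++ m :: S)
        (by rw [stackSort_append_cons (by simp) hSm, hs, hS]; simp)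
      exact append_singleton_ne_cons hSm h0 (h1.trans h2.symm)
    by_cases hA0 : A = []
    · subst hA0
      have hB0 : B = [] := flip B (by simp)
      subst hB0
      simp
    by_cases hB0 : B = []
    · subst hB0
      exact absurd (flip A (by simp)) hA0
    have h1 := ihA hA0 (fun v hv => by
      have hvm : ∀ x ∈ v, x < m := fun x hx => hA x (by rwa [← mem_stackSort, ← hv, mem_stackSort])
      have := huniq (v ++ m :: B) (by rw [stackSort_append_cons hvm hB, hs, hv])
      exact List.append_cancel_right this)
    have h2 := ihB hB0 (fun v hv => by
      have hvm : ∀ x ∈ v, x < m := fun x hx => hB x (by rwa [← mem_stackSort, ← hv, mem_stackSort])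
      have := huniq (A ++ m :: v) (by rw [stackSort_append_cons hA hvm, hs, hv])
      simpa using List.append_cancel_left this)
    obtain ⟨y, t, hyt⟩ := List.exists_cons_of_ne_nil (mt stackSort_eq_nil.1 hB0)
    obtain ⟨A', a, B', rfl, hA', hB'⟩ :
        ∃ A' a B', A = A' ++ a :: B' ∧ (∀ x ∈ A', x < a) ∧ (∀ x ∈ B', x < a) :=
      exists_eq_append_max_cons hA0 hnA
    -- If the seam between s(A) and s(B) were an ascent, `A` could be grafted onto `B`, and `flip`
    -- would apply to the result.
    have hya : y < a := by
      by_contra hle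
      have hay : a ≠ y := by
        refine (List.nodup_append.1 hn).2.2 a (by simp) y (List.mem_cons_of_mem _ ?_)
        rw [← mem_stackSort, hyt]
        simp
      obtain ⟨S, hS⟩ := exists_stackSort_eq_append (L := A' ++ a :: B') B hnB y t hyt (by
        intro x hx
        simp only [List.mem_append, List.mem_cons] at hx
        rcases hx with h | h | h
        · have := hA' x h; omega
        · omega
        · have := hB' x h; omega)
      have := flip S hS
      subst this
      simp at hS
    rw [hs, des_concat_of_le _ _ (fun x hx => by
      simp only [List.mem_append, mem_stackSort] at hx
      exact hx.elim (fun h => (hA x (by simpa using h)).le) (fun h => (hB x h).le)), hyt]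
    rw [hyt] at h2
    rw [stackSort_append_cons hA' hB'] at h1 ⊢
    rw [des_concat_append_cons, if_pos hya]
    simp only [List.length_append, List.length_cons] at h1 ⊢
    omega

/-- Since s(R) already has the maximal number of descents, the suffix x s(R) gains a descent but
only one letter, which breaks the suffix bound. -/
theorem false_of_stackSort_suffix {w R : List ℕ} {X : List ℕ} (hw : w.Nodup)
    {x y : ℕ} {t : List ℕ} (h : stackSort w = (X ++ [x]) ++ stackSort R) (hyt : stackSort R = y :: t)
    (hyx : y < x) (hd : 2 * des (stackSort R) + 1 = R.length) : False := by
  have h1 := two_mul_des_suffix_lt w hw (x :: stackSort R) ⟨X, by rw [h]; simp⟩ (by simp)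
  rw [List.length_cons, length_stackSort, hyt, des_cons_cons, if_pos hyx, ← hyt] at h1
  omega

/-- If `s(A m B)` has as many descents as a sorted word can have, then either `A` and `B` are both
empty, or the same holds for `s(A)` and `s(B)`, and there is a descent from `s(A)` to `s(B)`. -/
theorem exists_full_decomposition {A B : List ℕ} {m : ℕ} (hA : ∀ x ∈ A, x < m)
    (hB : ∀ x ∈ B, x < m) (h : (A ++ m :: B).Nodup)
    (hd : 2 * des (stackSort (A ++ m :: B)) + 1 = (A ++ m :: B).length) :
    (A = [] ∧ B = []) ∨ ∃ S a y t, stackSort A = S ++ [a] ∧ stackSort B = y :: t ∧ y < a ∧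
      (∀ x ∈ A, x ≤ a) ∧
      2 * des (stackSort A) + 1 = A.length ∧ 2 * des (stackSort B) + 1 = B.length := by
  have h1 := List.nodup_append.1 h
  have hnA := h1.1
  have hnB := (List.nodup_cons.1 h1.2.1).2
  rw [stackSort_append_cons hA hB, des_concat_of_le _ _ (fun x hx => by
      simp only [List.mem_append, mem_stackSort] at hx
      exact hx.elim (fun h => (hA x h).le) (fun h => (hB x h).le)), List.length_append,
      List.length_cons] at hd
  by_cases hA0 : A = []
  · subst hA0
    by_cases hB0 : B = []
    · exact Or.inl ⟨rfl, hB0⟩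
    · have := two_mul_des_stackSort_lt hnB hB0
      simp at hd
      omega
  have h2 := two_mul_des_stackSort_lt hnA hA0
  by_cases hB0 : B = []
  · subst hB0
    simp at hd
    omega
  have h3 := two_mul_des_stackSort_lt hnB hB0
  obtain ⟨y, t, hyt⟩ := List.exists_cons_of_ne_nil (mt stackSort_eq_nil.1 hB0)
  obtain ⟨A', a, B', rfl, hA', hB'⟩ := exists_eq_append_max_cons hA0 hnA
  have hs := stackSort_append_cons hA' hB'
  rw [hs, hyt, des_concat_append_cons, ← hs, ← hyt] at hd
  -- `hd` is compatible with the bounds `h2` and `h3` only if the seam is a descent and both bounds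
  -- are equalities.
  refine Or.inr ⟨_, a, y, t, hs, hyt, ?_, ?_, ?_, ?_⟩
  · by_contra hya
    rw [if_neg hya] at hd
    omega
  · intro x hx
    simp only [List.mem_append, List.mem_cons] at hx
    rcases hx with h | h | h
    · exact (hA' x h).le
    · exact h.le
    · exact (hB' x h).le
  all_goals split at hd <;> omega

/-- A sorted word of length `n` with `(n - 1) / 2` descents has only one preimage. -/
theorem stackSort_injective_of_des (w : List ℕ) (hw : w.Nodup) :
    2 * des (stackSort w) + 1 = w.length → ∀ v, stackSort v = stackSort w → v = w := by
  induction w, hw using nodup_max_induction with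
  | nil => intro h; simp at h
  | step A m B hA hB hn hnA hnB ihA ihB =>
    intro hd v hv
    have hp : v.Perm (A ++ m :: B) :=
      (stackSort_perm v).symm.trans (hv ▸ stackSort_perm _)
    have hnv : v.Nodup := hp.nodup_iff.2 hn
    have hv0 : v ≠ [] := by rintro rfl; simpa using hp.length_eq
    have hdv : 2 * des (stackSort v) + 1 = v.length := by rw [hv, hp.length_eq, hd]
    obtain ⟨A', m', B', rfl, hA', hB'⟩ := exists_eq_append_max_cons hv0 hnv
    have hfull := exists_full_decomposition hA hB hn hd
    have hfull' := exists_full_decomposition hA' hB' hnv hdv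
    rw [stackSort_append_cons hA hB, stackSort_append_cons hA' hB'] at hv
    obtain ⟨hAB, hmm⟩ := List.append_inj' hv rfl
    obtain rfl : m' = m := by simpa using hmm
    have hlen := hp.length_eq
    simp only [List.length_append, List.length_cons] at hlen
    have hnA' := (List.nodup_append.1 hnv).1
    have hnB' := (List.nodup_cons.1 (List.nodup_append.1 hnv).2.1).2
    rcases hfull with ⟨rfl, rfl⟩ | ⟨S, a, y, t, hSa, hyt, hya, haA, hdA, hdB⟩
    · have h1 : A' = [] := List.length_eq_zero_iff.1 (by simp at hlen; omega)
      have h2 : B' = [] := List.length_eq_zero_iff.1 (by simp at hlen; omega)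
      rw [h1, h2]
    rcases hfull' with ⟨rfl, rfl⟩ | ⟨S', a', y', t', hSa', hyt', hya', haA', hdA', hdB'⟩
    · simp only [stackSort_nil, List.append_nil] at hAB
      have := congrArg List.length hAB
      simp only [List.length_nil, length_stackSort, List.length_append, hSa, List.length_singleton] at this
      omega
    -- If `A'` were longer than `A`, then s(B) would end in a' s(B') with a descent at the seam,
    -- against `false_of_stackSort_suffix`. Used in both directions, this gives `A` and `A'` the
    -- same length.
    have aux : ∀ A A' B B' S S' a a' y t, B.Nodup → stackSort A' = S' ++ [a'] →
        stackSort B' = y :: t → y < a' →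
        2 * des (stackSort B') + 1 = B'.length →
        stackSort A' ++ stackSort B' = stackSort A ++ stackSort B →
        stackSort A = S ++ [a] → A'.length ≤ A.length := by
      intro A A' B B' S S' a a' y t hB hS hyt hya hd h hS2
      by_contra hlt
      obtain ⟨X, hX⟩ : ∃ X, stackSort A' = stackSort A ++ X := by
        rcases List.append_eq_append_iff.1 h with ⟨X, h1, h2⟩ | ⟨X, h1, h2⟩
        · have := congrArg List.length h1
          simp at this
          omega
        · exact ⟨X, h1⟩
      rcases List.eq_nil_or_concat' X with rfl | ⟨X, x, rfl⟩
      · have := congrArg List.length hX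
        simp at this
        omega
      · have hx : a' = x := by
          rw [hS, ← List.append_assoc] at hX
          simpa using (List.append_inj' hX rfl).2
        rw [hX, List.append_assoc] at h
        exact false_of_stackSort_suffix hB (List.append_cancel_left h).symm hyt (hx ▸ hya) hd
    have hl1 := aux A A' B B' S S' a a' y' t' hnB hSa' hyt' hya' hdB' hAB hSa
    have hl2 := aux A' A B' B S' S a' a y t hnB' hSa hyt hya hdB hAB.symm hSa'
    obtain ⟨h1, h2⟩ := List.append_inj hAB (by simp; omega)
    rw [ihA hdA A' h1, ihB hdB B' h2]

/-- A preimage is a rearrangement of `π`, hence automatically a permutation, so `IsPermWord` can be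
dropped from the definition of fertility. -/
theorem isUniquelySorted_iff {π : List ℕ} (h : IsPermWord π) :
    IsUniquelySorted π ↔ ∃ σ, stackSort σ = π ∧ ∀ v, stackSort v = π → v = σ := by
  have hset : {σ : List ℕ | IsPermWord σ ∧ stackSort σ = π} = {σ | stackSort σ = π} := by
    ext σ
    simp only [Set.mem_ofPred_eq, and_iff_right_iff_imp]
    rintro rfl
    exact ⟨(stackSort_perm σ).nodup_iff.1 h.1, fun a ha => h.2 a (by simpa using ha)⟩
  rw [IsUniquelySorted, fertility, hset, Set.encard_eq_one]
  simp only [Set.eq_singleton_iff_unique_mem, Set.mem_ofPred_eq]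

/-- A nonempty permutation is uniquely sorted if and only if it is sorted and has `(n - 1) / 2`
descents. -/
theorem isUniquelySorted_iff_des {π : List ℕ} (h : IsPermWord π) (h0 : π ≠ []) :
    IsUniquelySorted π ↔ (∃ σ, stackSort σ = π) ∧ 2 * des π + 1 = π.length := by
  rw [isUniquelySorted_iff h]
  constructor
  · rintro ⟨σ, rfl, hu⟩
    refine ⟨⟨σ, rfl⟩, ?_⟩
    rw [length_stackSort]
    exact two_mul_des_add_one_of_unique σ ((stackSort_perm σ).nodup_iff.1 h.1) (by simpa using h0) hu
  · rintro ⟨⟨σ, rfl⟩, hd⟩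
    rw [length_stackSort] at hd
    exact ⟨σ, rfl, stackSort_injective_of_des σ ((stackSort_perm σ).nodup_iff.1 h.1) hd⟩

/-! ### Patterns of length three as inequalities. -/

theorem exists_triple_of_normalization {ρ : List ℕ} {i j k : ℕ}
    (h : normalization ρ = [i, j, k]) : ∃ x y z, ρ = [x, y, z] := by
  have : ρ.length = 3 := by simpa [normalization] using congrArg List.length h
  exact List.length_eq_three.1 this

theorem normalization_triple (x y z : ℕ) : normalization [x, y, z] =
    [1 + (if y ≤ x then 1 else 0) + (if z ≤ x then 1 else 0),
      1 + (if x ≤ y then 1 else 0) + (if z ≤ y then 1 else 0),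
      1 + (if x ≤ z then 1 else 0) + (if y ≤ z then 1 else 0)] := by
  simp only [normalization, List.map_cons, List.map_nil, List.filter_cons, List.filter_nil,
    decide_eq_true_eq, le_refl, if_true]
  refine congrArg₂ _ ?_ (congrArg₂ _ ?_ (congrArg₂ _ ?_ rfl)) <;> split_ifs <;> rfl

theorem containsPattern_triple {σ : List ℕ} {i j k : ℕ} :
    ContainsPattern σ [i, j, k] ↔
      ∃ x y z, [x, y, z].Sublist σ ∧ normalization [x, y, z] = normalization [i, j, k] := by
  constructor
  · rintro ⟨ρ, h1, h2⟩
    obtain ⟨x, y, z, rfl⟩ := exists_triple_of_normalization (h2.trans (normalization_triple i j k))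
    exact ⟨x, y, z, h1, h2⟩
  · rintro ⟨x, y, z, h1, h2⟩
    exact ⟨_, h1, h2⟩

theorem containsPattern_132 {σ : List ℕ} :
    ContainsPattern σ [1, 3, 2] ↔ ∃ x y z, [x, y, z].Sublist σ ∧ x < z ∧ z < y := by
  rw [containsPattern_triple]
  refine exists_congr fun x => exists_congr fun y => exists_congr fun z => and_congr_right fun _ => ?_
  simp only [normalization_triple, List.cons.injEq, and_true]
  norm_num only [if_true, if_false]
  grind

theorem containsPattern_231 {σ : List ℕ} :
    ContainsPattern σ [2, 3, 1] ↔ ∃ x y z, [x, y, z].Sublist σ ∧ z < x ∧ x < y := by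
  rw [containsPattern_triple]
  refine exists_congr fun x => exists_congr fun y => exists_congr fun z => and_congr_right fun _ => ?_
  simp only [normalization_triple, List.cons.injEq, and_true]
  norm_num only [if_true, if_false]
  grind

theorem containsPattern_312 {σ : List ℕ} :
    ContainsPattern σ [3, 1, 2] ↔ ∃ x y z, [x, y, z].Sublist σ ∧ y < z ∧ z < x := by
  rw [containsPattern_triple]
  refine exists_congr fun x => exists_congr fun y => exists_congr fun z => and_congr_right fun _ => ?_
  simp only [normalization_triple, List.cons.injEq, and_true]
  norm_num only [if_true, if_false]
  grind

theorem containsPattern_321 {σ : List ℕ} :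
    ContainsPattern σ [3, 2, 1] ↔ ∃ x y z, [x, y, z].Sublist σ ∧ z < y ∧ y < x := by
  rw [containsPattern_triple]
  refine exists_congr fun x => exists_congr fun y => exists_congr fun z => and_congr_right fun _ => ?_
  simp only [normalization_triple, List.cons.injEq, and_true]
  norm_num only [if_true, if_false]
  grind

/-! ### Pair-layered words, the extremal shape 2 1 4 3 6 5 .... -/

/-- Words of odd length whose letters, read in consecutive pairs, form descents, and in which every
letter of a pair is smaller than all letters after the pair. -/
inductive PairLayered : List ℕ → Prop
  | single (x : ℕ) : PairLayered [x]
  | step (a b : ℕ) (t : List ℕ) (hba : b < a) (hat : ∀ y ∈ t, a < y) (ht : PairLayered t) :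
      PairLayered (a :: b :: t)

theorem PairLayered.ne_nil {w : List ℕ} (h : PairLayered w) : w ≠ [] := by
  cases h <;> simp

/-- The second letter is the minimum and the first is the next smallest, so the set of letters
determines the word pair by pair. -/
theorem PairLayered.eq_of_perm {v w : List ℕ} (hv : PairLayered v) (hw : PairLayered w)
    (h : v.Perm w) : v = w := by
  induction hv generalizing w with
  | single x => exact List.singleton_perm.1 h
  | step a b t hba hat ht ih =>
    cases hw with
    | single x => simpa using h.length_eq
    | step a' b' t' hba' hat' ht' =>
      have le_of_mem : ∀ {x a b : ℕ} {t : List ℕ}, b < a → (∀ y ∈ t, a < y) → x ∈ a :: b :: t →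
          b ≤ x ∧ (x ≠ b → a ≤ x) := by
        intro x a b t hba hat hx
        simp only [List.mem_cons] at hx
        rcases hx with h | h | h
        · omega
        · omega
        · have := hat x h; omega
      have h1 := le_of_mem hba' hat' (h.mem_iff.1 (show a ∈ a :: b :: t by simp))
      have h2 := le_of_mem hba' hat' (h.mem_iff.1 (show b ∈ a :: b :: t by simp))
      have h3 := le_of_mem hba hat (h.mem_iff.2 (show a' ∈ a' :: b' :: t' by simp))
      have h4 := le_of_mem hba hat (h.mem_iff.2 (show b' ∈ a' :: b' :: t' by simp))
      obtain rfl : b = b' := by omega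
      obtain rfl : a = a' := by omega
      rw [ih ht' h.cons_inv.cons_inv]

theorem PairLayered.two_mul_des {w : List ℕ} (h : PairLayered w) : 2 * des w + 1 = w.length := by
  induction h with
  | single x => simp
  | step a b t hba hat ht ih =>
    obtain ⟨y, t, rfl⟩ := List.exists_cons_of_ne_nil ht.ne_nil
    have := hat y (by simp)
    rw [des_cons_cons, des_cons_cons, if_pos hba, if_neg (by omega)]
    simp only [List.length_cons] at ih ⊢
    omega

/-- Each of 231, 312 and 321 ends below its first letter, so this one inequality excludes all three.
-/
theorem PairLayered.lt_of_sublist {w : List ℕ} (h : PairLayered w) {x y z : ℕ}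
    (hs : [x, y, z].Sublist w) : x < z := by
  induction h with
  | single x => simpa using hs.length_le
  | step a b t hba hat ht ih =>
    have key : ∀ {u : List ℕ}, [y, z].Sublist u → z ∈ u := fun h => h.subset (by simp)
    rcases List.sublist_cons_iff.1 hs with h | ⟨r, hr, h⟩
    · rcases List.sublist_cons_iff.1 h with h | ⟨r, hr, h⟩
      · exact ih h
      · obtain ⟨rfl, rfl⟩ := List.cons_eq_cons.1 hr
        exact hba.trans (hat z (key h))
    · obtain ⟨rfl, rfl⟩ := List.cons_eq_cons.1 hr
      rcases List.sublist_cons_iff.1 h with h | ⟨r, hr, h⟩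
      · exact hat z (key h)
      · obtain ⟨rfl, rfl⟩ := List.cons_eq_cons.1 hr
        exact hat z (h.subset (by simp))

/-- A preimage grows from left to right: if `A` sorts to v a, and y is the letter after the pair a
b, then A y b sorts to v a b y. The prefix `v` carries the letters already placed. -/
theorem PairLayered.exists_stackSort {w : List ℕ} (h : PairLayered w) :
    ∀ a t, w = a :: t → ∀ A v, (∀ x ∈ A, x ≤ a) → stackSort A = v ++ [a] →
      ∃ σ, stackSort σ = v ++ w := by
  induction h with
  | single x =>
    rintro a t ⟨⟩ A v - hA
    exact ⟨A, hA⟩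
  | step a b t hba hat ht ih =>
    rintro _ _ ⟨⟩ A v hle hA
    obtain ⟨y, t, rfl⟩ := List.exists_cons_of_ne_nil ht.ne_nil
    have hy := hat y (by simp)
    have hA' : ∀ x ∈ A, x < y := fun x hx => (hle x hx).trans_lt hy
    have hb : ∀ x ∈ [b], x < y := by simp; omega
    obtain ⟨σ, hσ⟩ := ih y t rfl (A ++ y :: [b]) (v ++ [a, b]) (by
      intro x hx
      simp only [List.mem_append, List.mem_cons, List.not_mem_nil, or_false] at hx
      rcases hx with h | h | h
      · exact (hA' x h).le
      · exact h.le
      · omega) (by rw [stackSort_append_cons hA' hb, hA]; simp)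
    exact ⟨σ, by rw [hσ]; simp⟩

theorem PairLayered.sorted {w : List ℕ} (h : PairLayered w) : ∃ σ, stackSort σ = w := by
  obtain ⟨a, t, rfl⟩ := List.exists_cons_of_ne_nil h.ne_nil
  exact h.exists_stackSort a t rfl [a] [] (by simp) (by simp)

theorem exists_pairLayered (k c : ℕ) :
    ∃ w, PairLayered w ∧ w.Perm (List.range' c (2 * k + 1)) := by
  induction k generalizing c with
  | zero => exact ⟨[c], .single c, by simp⟩
  | succ k ih =>
    obtain ⟨w, hw, hp⟩ := ih (c + 2)
    refine ⟨(c + 1) :: c :: w, .step _ _ _ (by omega) (fun y hy => ?_) hw, ?_⟩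
    · have := hp.mem_iff.1 hy
      rw [List.mem_range'_1] at this
      omega
    · rw [show 2 * (k + 1) + 1 = (2 * k + 1) + 1 + 1 by ring, List.range'_succ, List.range'_succ]
      exact (List.Perm.swap _ _ _).trans ((hp.cons _).cons _)

/-! ### Words with the maximal number of descents that avoid 321. -/

/-- Words with as many descents as a sorted word of the same length can have, in which no suffix
has too many descents for a sorted word. -/
def DescentTight (w : List ℕ) : Prop :=
  (∀ W, W <:+ w → W ≠ [] → 2 * des W + 1 ≤ W.length) ∧ 2 * des w + 1 = w.length

/-- Without a descent at the start, the suffix omitting `a` would keep all the descents with one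
letter less, against its bound. After the descent from `a` to `b`, avoiding 321 forbids another one,
so two letters leave together with exactly one descent. -/
theorem DescentTight.tail_tail {a b : ℕ} {t : List ℕ} (h : DescentTight (a :: b :: t))
    (h321 : ∀ x y z, [x, y, z].Sublist (a :: b :: t) → z < y → ¬ y < x) :
    b < a ∧ (∃ r t', t = r :: t' ∧ b ≤ r) ∧ DescentTight t := by
  obtain ⟨hsuf, hd⟩ := h
  cases t with
  | nil => simp at hd
  | cons r t =>
    have h1 := hsuf (b :: r :: t) ⟨[a], rfl⟩ (by simp)
    have h2 := hsuf (r :: t) ⟨[a, b], rfl⟩ (by simp)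
    have h3 := h321 a b r (by simp)
    simp only [des_cons_cons, List.length_cons] at hd h1 h2
    have hba : b < a := by
      by_contra hba
      rw [if_neg hba] at hd
      omega
    have hbr : ¬ r < b := fun h => h3 h hba
    rw [if_pos hba, if_neg hbr] at hd
    refine ⟨hba, ⟨r, t, rfl, by omega⟩, fun W hW => hsuf W (hW.trans ⟨[a, b], rfl⟩), ?_⟩
    rw [List.length_cons]
    omega

theorem DescentTight.pairLayered {w : List ℕ} (h : DescentTight w) (hn : w.Nodup)
    (hmax : ∀ v m, w = v ++ [m] → ∀ y ∈ v, y < m)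
    (h321 : ∀ x y z, [x, y, z].Sublist w → z < y → ¬ y < x)
    (hor : (∀ x y z, [x, y, z].Sublist w → z < x → ¬ x < y) ∨
      (∀ x y z, [x, y, z].Sublist w → y < z → ¬ z < x)) : PairLayered w := by
  induction hl : w.length using Nat.strong_induction_on generalizing w with
  | _ n ih =>
    match w, hl with
    | [], _ => simpa using h.2
    | [x], _ => exact .single x
    | a :: b :: t, hl =>
      obtain ⟨hba, ⟨r, t', rfl, hbr⟩, ht⟩ := h.tail_tail h321
      have hsub : (r :: t').Sublist (a :: b :: r :: t') := by simp
      have hpair := ih (r :: t').length (by simp only [List.length_cons] at hl ⊢; omega) ht (hsub.nodup hn)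
        (fun v m hv => fun y hy => hmax (a :: b :: v) m (by rw [hv]; rfl) y (by simp [hy]))
        (fun x y z h => h321 x y z (h.trans hsub))
        (hor.imp (fun H x y z h => H x y z (h.trans hsub)) (fun H x y z h => H x y z (h.trans hsub)))
        rfl
      have hne : ∀ y ∈ r :: t', y ≠ a ∧ y ≠ b := by
        intro y hy
        simp only [List.nodup_cons] at hn
        refine ⟨?_, ?_⟩
        · rintro rfl; exact hn.1 (List.mem_cons_of_mem _ hy)
        · rintro rfl; exact hn.2.1 hy
      refine .step a b _ hba ?_ hpair
      -- It remains to place `a` below all later letters. With 231 and 321 excluded, the triple a r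
      -- b' gives a < b', and b' is the least letter after `b`. With 312 and 321 excluded, each
      -- triple a b y gives a < y directly.
      rcases hor with H | H
      · cases hpair with
        -- With one letter `r` left, the word 3 1 2 avoids both 231 and 321; it is excluded because
        -- the last letter is the largest.
        | single =>
          intro y hy
          rw [List.mem_singleton.1 hy]
          exact hmax [a, b] r rfl a (by simp)
        | step _ b' s hba' hat' _ =>
          have h1 : a < b' := by
            have e1 := h321 a r b' (by simp)
            have e2 := H a r b' (by simp)
            have e3 := hne b' (by simp)
            have e4 := hne r (by simp)
            omega
          intro y hy
          simp only [List.mem_cons] at hy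
          rcases hy with rfl | rfl | hy
          · omega
          · exact h1
          · have := hat' y hy; omega
      · intro y hy
        have hs : [a, b, y].Sublist (a :: b :: r :: t') := by
          simpa using hy
        have e1 := h321 a b y hs
        have e2 := H a b y hs
        have e3 := hne y hy
        omega

/-! ### Valleys: the shape forced by avoiding 132, 231 and 312. -/

theorem des_eq_zero_of_pairwise_lt {E : List ℕ} (h : E.Pairwise (· < ·)) : des E = 0 := by
  induction E with
  | nil => rfl
  | cons a E ih =>
    cases E with
    | nil => rfl
    | cons b E =>
      have h1 := List.pairwise_cons.1 h
      have := h1.1 b (by simp)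
      rw [des_cons_cons, if_neg (by omega), ih h1.2]

/-- The word `U E` decreases along `U`, then increases along `E`, and the letters of `E` are larger
than those of `U`. -/
def IsValley (U E : List ℕ) : Prop :=
  U.Pairwise (· > ·) ∧ E.Pairwise (· < ·) ∧ ∀ x ∈ U, ∀ y ∈ E, x < y

/-- All descents lie inside `U`, so the descent count determines where the valley turns. -/
theorem IsValley.des_add_one {U E : List ℕ} (h : IsValley U E) (hU : U ≠ []) :
    des (U ++ E) + 1 = U.length := by
  induction U with
  | nil => exact absurd rfl hU
  | cons a U ih =>
    obtain ⟨h1, h2, h3⟩ := h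
    cases U with
    | nil =>
      have : (a :: E).Pairwise (· < ·) := List.pairwise_cons.2 ⟨h3 a (by simp), h2⟩
      simpa using des_eq_zero_of_pairwise_lt this
    | cons b U =>
      have h4 := List.pairwise_cons.1 h1
      have h5 := ih ⟨h4.2, h2, fun x hx => h3 x (List.mem_cons_of_mem _ hx)⟩ (by simp)
      have h6 : b < a := h4.1 b (by simp)
      simp only [List.cons_append, des_cons_cons, if_pos h6, List.length_cons] at h5 ⊢
      omega

/-- The first conjunct covers both 132 and 231, whose largest letter is in the middle; the second
covers 312. -/
theorem IsValley.triple {U E : List ℕ} (h : IsValley U E) {x y z : ℕ}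
    (hs : [x, y, z].Sublist (U ++ E)) : ¬ (x < y ∧ z < y) ∧ ¬ (y < z ∧ z < x) := by
  obtain ⟨h1, h2, h3⟩ := h
  obtain ⟨l, r, hlr, hl, hr⟩ := List.sublist_append_iff.1 hs
  have hl' := h1.sublist hl
  have hr' := h2.sublist hr
  have hx : ∀ x ∈ l, ∀ y ∈ r, x < y := fun x hx y hy => h3 x (hl.subset hx) y (hr.subset hy)
  match l, hlr with
  | [], hlr =>
    subst hlr
    simp at hr'
    omega
  | [_], hlr =>
    simp at hlr
    obtain ⟨rfl, rfl⟩ := hlr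
    simp at hr' hx
    omega
  | [_, _], hlr =>
    simp at hlr
    obtain ⟨rfl, rfl, rfl⟩ := hlr
    simp at hl' hx
    omega
  | _ :: _ :: _ :: _, hlr =>
    simp at hlr
    obtain ⟨rfl, rfl, rfl, rfl, rfl⟩ := hlr
    simp at hl'
    omega

/-- A letter `a` is prepended to a valley starting with `u`. If u < a, avoiding 312 keeps `a` below
`E`, and `a` joins the decreasing run. If a < u, a second letter v of the decreasing run would make
a u v a 132 or 231, so that run is just `u`, which moves to the increasing run. -/
theorem exists_isValley {w : List ℕ} (h0 : w ≠ []) (hn : w.Nodup)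
    (h132 : ∀ x y z, [x, y, z].Sublist w → x < z → ¬ z < y)
    (h231 : ∀ x y z, [x, y, z].Sublist w → z < x → ¬ x < y)
    (h312 : ∀ x y z, [x, y, z].Sublist w → y < z → ¬ z < x) :
    ∃ U E, w = U ++ E ∧ U ≠ [] ∧ IsValley U E := by
  induction w with
  | nil => exact absurd rfl h0
  | cons a t ih =>
    by_cases ht : t = []
    · subst ht
      exact ⟨[a], [], rfl, by simp, by simp, by simp, by simp⟩
    have hsub : t.Sublist (a :: t) := by simp
    obtain ⟨U, E, rfl, hU, h1, h2, h3⟩ := ih ht (hsub.nodup hn)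
      (fun x y z h => h132 x y z (h.trans hsub)) (fun x y z h => h231 x y z (h.trans hsub))
      (fun x y z h => h312 x y z (h.trans hsub))
    obtain ⟨u, U, rfl⟩ := List.exists_cons_of_ne_nil hU
    have hne : ∀ y ∈ u :: U ++ E, y ≠ a := by
      rintro y hy rfl
      exact (List.nodup_cons.1 hn).1 hy
    have hu := hne u (by simp)
    rcases lt_or_gt_of_ne hu with hua | hua
    · refine ⟨a :: u :: U, E, rfl, by simp, ?_, h2, ?_⟩
      · refine List.pairwise_cons.2 ⟨fun x hx => ?_, h1⟩
        rcases List.mem_cons.1 hx with rfl | hx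
        · exact hua
        · have := (List.pairwise_cons.1 h1).1 x hx
          omega
      · intro x hx y hy
        rcases List.mem_cons.1 hx with rfl | hx
        · have e1 := h312 x u y (by simp [hy]) (h3 u (by simp) y hy)
          have e2 := hne y (by simp [hy])
          omega
        · exact h3 x hx y hy
    · cases U with
      | nil =>
        refine ⟨[a], u :: E, rfl, by simp, by simp, ?_, ?_⟩
        · exact List.pairwise_cons.2 ⟨h3 u (by simp), h2⟩
        · intro x hx y hy
          rw [List.mem_singleton.1 hx]
          rcases List.mem_cons.1 hy with rfl | hy
          · exact hua
          · exact hua.trans (h3 u (by simp) y hy)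
      | cons v U =>
        have hv : v < u := (List.pairwise_cons.1 h1).1 v (by simp)
        have e1 := h132 a u v (by simp)
        have e2 := h231 a u v (by simp)
        have e3 := hne v (by simp)
        omega

/-- Reversing `U` turns a valley into an increasing word, which its letters determine; the length of
`U` then recovers the cut. -/
theorem IsValley.eq_of_perm {U E U' E' : List ℕ} (h : IsValley U E) (h' : IsValley U' E')
    (hp : (U ++ E).Perm (U' ++ E')) (hl : U.length = U'.length) : U ++ E = U' ++ E' := by
  have key : ∀ {U E}, IsValley U E → (U.reverse ++ E).Pairwise (· < ·) := by
    rintro U E ⟨h1, h2, h3⟩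
    refine List.pairwise_append.2 ⟨List.pairwise_reverse.2 h1, h2, fun x hx y hy => ?_⟩
    exact h3 x (List.mem_reverse.1 hx) y hy
  have hp' : (U.reverse ++ E).Perm (U'.reverse ++ E') :=
    ((List.reverse_perm U).append_right E).trans
      (hp.trans ((List.reverse_perm U').append_right E').symm)
  have heq := hp'.eq_of_pairwise (fun a b _ _ h1 h2 => absurd h1 (lt_asymm h2)) (key h) (key h')
  obtain ⟨h1, rfl⟩ := List.append_inj heq (by simpa using hl)
  rw [List.reverse_injective h1]

/-- The start `c + 1` of the increasing run is kept independent of `j`, since the induction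
lengthens both runs while that start stays fixed. -/
theorem exists_stackSort_eq_valley (j c : ℕ) (hc : j + 1 ≤ c) :
    ∃ σ, stackSort σ = (List.range' 1 (j + 1)).reverse ++ List.range' (c + 1) j := by
  induction j with
  | zero => exact ⟨[1], by simp⟩
  | succ j ih =>
    obtain ⟨σ, hσ⟩ := ih (by omega)
    -- The new maximum `c + 1 + j` goes to the end after sorting, and `j + 2`, to its left, lands in
    -- front of the old valley.
    refine ⟨[j + 2] ++ (c + 1 + j) :: σ, ?_⟩
    rw [stackSort_append_cons, hσ, stackSort_singleton, List.range'_1_concat (s := c + 1),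
      List.range'_1_concat (n := j + 1)]
    · simp; omega
    · simp; omega
    · intro x hx
      rw [← mem_stackSort, hσ, List.mem_append, List.mem_reverse, List.mem_range'_1,
        List.mem_range'_1] at hx
      omega

/-! ### Counting the avoidance classes. -/

theorem mem_uniquelySortedAvoiding {k : ℕ} {T : Set (List ℕ)} {π : List ℕ} :
    π ∈ uniquelySortedAvoiding (2 * k + 1) T ↔ π.Perm (List.range' 1 (2 * k + 1)) ∧
      (∃ σ, stackSort σ = π) ∧ 2 * des π + 1 = π.length ∧ ∀ τ ∈ T, ¬ ContainsPattern π τ := by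
  have h : π.Perm (List.range' 1 (2 * k + 1)) → (IsUniquelySorted π ↔
      (∃ σ, stackSort σ = π) ∧ 2 * des π + 1 = π.length) := fun hp =>
    isUniquelySorted_iff_des ⟨hp.nodup_iff.2 List.nodup_range', fun a ha => by
      have := hp.mem_iff.1 ha
      rw [List.mem_range'_1] at this
      omega⟩ (by rintro rfl; simpa using hp.length_eq)
  simp only [uniquelySortedAvoiding, permsOf, Set.mem_ofPred_eq]
  constructor
  · rintro ⟨hp, hu, hT⟩
    exact ⟨hp, ((h hp).1 hu).1, ((h hp).1 hu).2, hT⟩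
  · rintro ⟨hp, hs, hd, hT⟩
    exact ⟨hp, (h hp).2 ⟨hs, hd⟩, hT⟩

theorem descentTight_stackSort {σ : List ℕ} (h : (stackSort σ).Nodup)
    (hd : 2 * des (stackSort σ) + 1 = (stackSort σ).length) : DescentTight (stackSort σ) :=
  ⟨two_mul_des_suffix_lt σ ((stackSort_perm σ).nodup_iff.1 h), hd⟩

theorem lt_last_of_stackSort {σ v : List ℕ} {m : ℕ} (hn : (stackSort σ).Nodup)
    (h : stackSort σ = v ++ [m]) : ∀ y ∈ v, y < m := by
  have hσ : σ ≠ [] := by rintro rfl; simp at h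
  obtain ⟨A, m', B, rfl, hA, hB⟩ :=
    exists_eq_append_max_cons hσ ((stackSort_perm σ).nodup_iff.1 hn)
  rw [stackSort_append_cons hA hB] at h
  obtain ⟨rfl, hm⟩ := List.append_inj' h rfl
  obtain rfl : m' = m := by simpa using hm
  intro y hy
  simp only [List.mem_append, mem_stackSort] at hy
  exact hy.elim (hA y) (hB y)

/-- One argument serves three classes: 321 with either of 231 and 312 forces a pair-layered word,
and that word avoids all three patterns. -/
theorem encard_uniquelySortedAvoiding_eq_one_of_subset {k : ℕ} {T : Set (List ℕ)}
    (hT : T ⊆ {[2, 3, 1], [3, 1, 2], [3, 2, 1]}) (h321 : [3, 2, 1] ∈ T)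
    (hor : [2, 3, 1] ∈ T ∨ [3, 1, 2] ∈ T) :
    (uniquelySortedAvoiding (2 * k + 1) T).encard = 1 := by
  have key : ∀ π ∈ uniquelySortedAvoiding (2 * k + 1) T,
      PairLayered π ∧ π.Perm (List.range' 1 (2 * k + 1)) := by
    intro π hπ
    obtain ⟨hp, ⟨σ, rfl⟩, hd, hav⟩ := mem_uniquelySortedAvoiding.1 hπ
    have hn : (stackSort σ).Nodup := hp.nodup_iff.2 List.nodup_range'
    refine ⟨(descentTight_stackSort hn hd).pairLayered hn (fun v m h => lt_last_of_stackSort hn h)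
      (fun x y z hs h1 h2 => hav _ h321 (containsPattern_321.2 ⟨x, y, z, hs, h1, h2⟩)) ?_, hp⟩
    exact hor.imp
      (fun h x y z hs h1 h2 => hav _ h (containsPattern_231.2 ⟨x, y, z, hs, h1, h2⟩))
      (fun h x y z hs h1 h2 => hav _ h (containsPattern_312.2 ⟨x, y, z, hs, h1, h2⟩))
  obtain ⟨w, hw, hp⟩ := exists_pairLayered k 1
  have hmem : w ∈ uniquelySortedAvoiding (2 * k + 1) T := by
    refine mem_uniquelySortedAvoiding.2 ⟨hp, hw.sorted, hw.two_mul_des, fun τ hτ hc => ?_⟩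
    rcases hT hτ with rfl | rfl | rfl
    · obtain ⟨x, y, z, hs, h1, h2⟩ := containsPattern_231.1 hc
      have := hw.lt_of_sublist hs
      omega
    · obtain ⟨x, y, z, hs, h1, h2⟩ := containsPattern_312.1 hc
      have := hw.lt_of_sublist hs
      omega
    · obtain ⟨x, y, z, hs, h1, h2⟩ := containsPattern_321.1 hc
      have := hw.lt_of_sublist hs
      omega
  refine Set.encard_eq_one.2 ⟨w, Set.eq_singleton_iff_unique_mem.2 ⟨hmem, fun v hv => ?_⟩⟩
  obtain ⟨h1, h2⟩ := key v hv
  exact h1.eq_of_perm hw (h2.trans hp.symm)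

theorem encard_uniquelySortedAvoiding_132_231_312 (k : ℕ) :
    (uniquelySortedAvoiding (2 * k + 1) {[1, 3, 2], [2, 3, 1], [3, 1, 2]}).encard = 1 := by
  have hval : IsValley (List.range' 1 (k + 1)).reverse (List.range' (k + 2) k) := by
    refine ⟨List.pairwise_reverse.2 List.pairwise_lt_range', List.pairwise_lt_range', ?_⟩
    intro x hx y hy
    rw [List.mem_reverse, List.mem_range'_1] at hx
    rw [List.mem_range'_1] at hy
    omega
  have hperm : ((List.range' 1 (k + 1)).reverse ++ List.range' (k + 2) k).Perm
      (List.range' 1 (2 * k + 1)) := by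
    refine ((List.reverse_perm _).append_right _).trans (List.Perm.of_eq ?_)
    have := List.range'_append_1 (s := 1) (m := k + 1) (n := k)
    rw [show k + 2 = 1 + (k + 1) by ring, this]
    congr 1
    omega
  have hmem : (List.range' 1 (k + 1)).reverse ++ List.range' (k + 2) k ∈
      uniquelySortedAvoiding (2 * k + 1) {[1, 3, 2], [2, 3, 1], [3, 1, 2]} := by
    refine mem_uniquelySortedAvoiding.2 ⟨hperm, exists_stackSort_eq_valley k (k + 1) le_rfl, ?_, ?_⟩
    · have := hval.des_add_one (by simp)
      simp only [List.length_append, List.length_reverse, List.length_range'] at this ⊢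
      omega
    · intro τ hτ hc
      rcases hτ with rfl | rfl | rfl
      · obtain ⟨x, y, z, hs, h1, h2⟩ := containsPattern_132.1 hc
        have := hval.triple hs
        omega
      · obtain ⟨x, y, z, hs, h1, h2⟩ := containsPattern_231.1 hc
        have := hval.triple hs
        omega
      · obtain ⟨x, y, z, hs, h1, h2⟩ := containsPattern_312.1 hc
        have := hval.triple hs
        omega
  refine Set.encard_eq_one.2 ⟨_, Set.eq_singleton_iff_unique_mem.2 ⟨hmem, fun v hv => ?_⟩⟩
  obtain ⟨hp, -, hd, hav⟩ := mem_uniquelySortedAvoiding.1 hv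
  obtain ⟨U, E, rfl, hU, hUE⟩ := exists_isValley (w := v) (by rintro rfl; simp at hd)
    (hp.nodup_iff.2 List.nodup_range')
    (fun x y z hs h1 h2 => hav _ (by simp) (containsPattern_132.2 ⟨x, y, z, hs, h1, h2⟩))
    (fun x y z hs h1 h2 => hav _ (by simp) (containsPattern_231.2 ⟨x, y, z, hs, h1, h2⟩))
    (fun x y z hs h1 h2 => hav _ (by simp) (containsPattern_312.2 ⟨x, y, z, hs, h1, h2⟩))
  -- The number of descents is k, so the decreasing run has k + 1 letters.
  refine hUE.eq_of_perm hval (hp.trans hperm.symm) ?_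
  have h1 := hUE.des_add_one hU
  have h2 := hp.length_eq
  rw [List.length_range'] at h2
  simp only [List.length_reverse, List.length_range']
  omega

/-- For k ≥ 2 the word starts with two descents a > b and c > d. Avoiding 321 in a b d gives b < d,
and then b c d is a 132. -/
theorem uniquelySortedAvoiding_132_321_eq_empty {k : ℕ} (hk : 2 ≤ k) :
    uniquelySortedAvoiding (2 * k + 1) {[1, 3, 2], [3, 2, 1]} = ∅ := by
  refine Set.eq_empty_iff_forall_notMem.2 fun π hπ => ?_
  obtain ⟨hp, ⟨σ, hσ⟩, hd, hav⟩ := mem_uniquelySortedAvoiding.1 hπ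
  have hn : π.Nodup := hp.nodup_iff.2 List.nodup_range'
  have hl : π.length = 2 * k + 1 := by simpa using hp.length_eq
  have h132 : ∀ x y z, [x, y, z].Sublist π → x < z → ¬ z < y := fun x y z hs h1 h2 =>
    hav _ (by simp) (containsPattern_132.2 ⟨x, y, z, hs, h1, h2⟩)
  have h321 : ∀ x y z, [x, y, z].Sublist π → z < y → ¬ y < x := fun x y z hs h1 h2 =>
    hav _ (by simp) (containsPattern_321.2 ⟨x, y, z, hs, h1, h2⟩)
  have ht : DescentTight π := by
    subst hσ
    exact descentTight_stackSort hn hd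
  match π, hl with
  | [], hl => simp at hl
  | [_], hl => simp at hl; omega
  | [_, _], hl => simp at hl
  | [_, _, _], hl => simp at hl; omega
  | a :: b :: c :: d :: t, _ =>
    obtain ⟨hba, -, ht'⟩ := ht.tail_tail h321
    obtain ⟨hdc, -, -⟩ := ht'.tail_tail
      (fun x y z hs => h321 x y z (hs.trans ((List.sublist_cons_self _ _).trans
        (List.sublist_cons_self _ _))))
    have h1 := h132 b c d (by simp)
    have h2 := h321 a b d (by simp)
    have h3 : b ≠ d := by
      rintro rfl
      simp at hn
    omega

theorem theorem11 :
    (∀ k : ℕ,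
      (uniquelySortedAvoiding (2 * k + 1) {[2, 3, 1], [3, 2, 1]}).encard = 1 ∧
      (uniquelySortedAvoiding (2 * k + 1) {[3, 1, 2], [3, 2, 1]}).encard = 1 ∧
      (uniquelySortedAvoiding (2 * k + 1) {[2, 3, 1], [3, 1, 2], [3, 2, 1]}).encard = 1 ∧
      (uniquelySortedAvoiding (2 * k + 1) {[1, 3, 2], [2, 3, 1], [3, 1, 2]}).encard = 1) ∧
    (∀ k : ℕ, 2 ≤ k →
      uniquelySortedAvoiding (2 * k + 1) {[1, 3, 2], [3, 2, 1]} = ∅) := by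
  refine ⟨fun k => ⟨?_, ?_, ?_, encard_uniquelySortedAvoiding_132_231_312 k⟩,
    fun k hk => uniquelySortedAvoiding_132_321_eq_empty hk⟩
  · exact encard_uniquelySortedAvoiding_eq_one_of_subset (by grind) (by simp) (by simp)
  · exact encard_uniquelySortedAvoiding_eq_one_of_subset (by grind) (by simp) (by simp)
  · exact encard_uniquelySortedAvoiding_eq_one_of_subset (by grind) (by simp) (by simp)
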